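/- Give the complex projective line $\mathbb{C}P^1$ the Fubini--Study metric, whose fundamental $2$-form in an affine coordinate $z$ is $\omega_{FS}=\frac{\sqrt{-1}}{2\pi}\partial\bar\partial\log(1+|z|^2)$. For a complex manifold $X$ with a Hermitian metric $g$ with fundamental form $\omega$, and a holomorphic map $f:\mathbb{C}\to X$, put $|df|(z):=\sqrt2\,|df(\partial/\partial z)|$, so that $f^*\omega=|df|^2\,dx\wedge dy$, and define the holomorphic capacity $$\rho(X,\omega):=\sup_{f}\ \limsup_{R\to\infty}\frac{1}{\pi R^2}\int_{|z|\le R}|df|^2\,dx\,dy,$$ where the supremum is over all holomorphic maps $f:\mathbb{C}\to X$ with $|df|(z)\le 1$ for all $z\in\mathbb{C}$. **Theorem.** Let $w_1$ and $w_2$ be two distinct points of $\mathbb{C}P^1$. Then $$\rho\bigl(\mathbb{C}P^1\setminus\{w_1,w_2\},\ \omega_{FS}\bigr)=0,$$ where $\mathbb{C}P^1\setminus\{w_1,w_2\}$ carries the restriction of the Fubini--Study metric. -/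

import Mathlib

open Set Filter Topology MeasureTheory
open scoped Manifold ContDiff LinearAlgebra.Projectivization ComplexConjugate ENNReal Laplacian

noncomputable section

/-! ### Hermitian metrics on complex manifolds -/

/-- A Hermitian metric on a complex manifold `X` modelled on `E`: a Riemannian metric `g` on the
real tangent spaces (the complex structure `J` is multiplication by `Complex.I`) with
`g (J u) (J v) = g u v`, whose coefficients are smooth in every chart. -/
structure HermitianMetric (E : Type*) [NormedAddCommGroup E] [NormedSpace ℂ E]
    [FiniteDimensional ℂ E] (X : Type*) [TopologicalSpace X] [ChartedSpace E X]
    [IsManifold 𝓘(ℂ, E) ω X] where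
  /-- The Riemannian metric `g`. -/
  g : ∀ x : X, TangentSpace 𝓘(ℂ, E) x → TangentSpace 𝓘(ℂ, E) x → ℝ
  symm : ∀ x u v, g x u v = g x v u
  add_left : ∀ x u u' v, g x (u + u') v = g x u v + g x u' v
  smul_left : ∀ x (c : ℝ) u v, g x ((c : ℂ) • u) v = c * g x u v
  pos : ∀ x u, u ≠ 0 → 0 < g x u u
  compatible : ∀ x u v, g x (Complex.I • u) (Complex.I • v) = g x u v
  smooth : ∀ e ∈ atlas E X, ∀ u v : E,
    ContDiffOn ℝ ∞ (fun y : E ↦ g (e.symm y) (mfderiv 𝓘(ℂ, E) 𝓘(ℂ, E) e.symm y u)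
      (mfderiv 𝓘(ℂ, E) 𝓘(ℂ, E) e.symm y v)) e.target

/-- The inclusion of an open subset identifies the tangent spaces. -/
theorem mfderiv_opens_val {E : Type*} [NormedAddCommGroup E] [NormedSpace ℂ E]
    {X : Type*} [TopologicalSpace X] [ChartedSpace E X] (U : TopologicalSpace.Opens X) (x : U)
    (u : TangentSpace 𝓘(ℂ, E) x) :
    mfderiv 𝓘(ℂ, E) 𝓘(ℂ, E) (Subtype.val : U → X) x u = u := by
  have key : HasMFDerivAt 𝓘(ℂ, E) 𝓘(ℂ, E) (Subtype.val : U → X) x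
      (ContinuousLinearMap.id ℂ E) := by
    refine ⟨continuous_subtype_val.continuousAt, ?_⟩
    refine HasFDerivAt.hasFDerivWithinAt ?_
    refine (hasFDerivAt_id _).congr_of_eventuallyEq ?_
    have hx : (chartAt E x.1).subtypeRestr ⟨x⟩ x ∈
        ((chartAt E x.1).subtypeRestr ⟨x⟩).target :=
      (chartAt E x.1).map_subtype_source ⟨x⟩ (mem_chart_source E x.1)
    filter_upwards [((chartAt E x.1).subtypeRestr ⟨x⟩).open_target.mem_nhds hx] with y hy
    have h1 := (chartAt E x.1).subtypeRestr_symm_apply ⟨x⟩ hy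
    change chartAt E x.1 ((Subtype.val ∘ ((chartAt E x.1).subtypeRestr ⟨x⟩).symm) y) = y
    rw [h1]
    exact (chartAt E x.1).right_inv ((chartAt E x.1).subtypeRestr_target_subset ⟨x⟩ hy)
  rw [key.mfderiv]
  rfl

section Capacity

variable {E : Type*} [NormedAddCommGroup E] [NormedSpace ℂ E] [FiniteDimensional ℂ E]
  {X : Type*} [TopologicalSpace X] [ChartedSpace E X] [IsManifold 𝓘(ℂ, E) ω X]

/-- The norm of the differential, `|df|(z) = √2 |df(∂/∂z)|`. Since
`∂/∂z = (∂/∂x - √-1 ∂/∂y) / 2`, the vector `df(∂/∂z)` of the complexified tangent space is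
`a + √-1 b` with `a = df(∂/∂x) / 2` and `b = - df(∂/∂y) / 2` real tangent vectors, and
`|a + √-1 b|² = g(a, a) + g(b, b)` for the Hermitian extension of `g`. -/
def HermitianMetric.normDiff (h : HermitianMetric E X) (f : ℂ → X) (z : ℂ) : ℝ :=
  let a : TangentSpace 𝓘(ℂ, E) (f z) := (1 / 2 : ℂ) • mfderiv 𝓘(ℂ) 𝓘(ℂ, E) f z (1 : ℂ)
  let b : TangentSpace 𝓘(ℂ, E) (f z) := (-1 / 2 : ℂ) • mfderiv 𝓘(ℂ) 𝓘(ℂ, E) f z Complex.I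
  √2 * √(h.g (f z) a a + h.g (f z) b b)

/-- The moduli space of holomorphic curves `f : ℂ → X` with `|df| ≤ 1`. -/
def HermitianMetric.moduli (h : HermitianMetric E X) : Set (ℂ → X) :=
  {f | MDifferentiable 𝓘(ℂ) 𝓘(ℂ, E) f ∧ ∀ z : ℂ, h.normDiff f z ≤ 1}

/-- The packing density `ρ(f) = limsup_{R → ∞} (1 / (π R²)) ∫_{|z| ≤ R} |df|² dx dy`,
as an extended nonnegative real. -/
def HermitianMetric.packingDensity (h : HermitianMetric E X) (f : ℂ → X) : ℝ≥0∞ :=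
  limsup (fun R : ℝ ↦
    (∫⁻ z in Metric.closedBall (0 : ℂ) R, ENNReal.ofReal (h.normDiff f z ^ 2)) /
      ENNReal.ofReal (Real.pi * R ^ 2)) atTop

/-- The holomorphic capacity, the supremum of `ρ(f)` over the moduli space. -/
def HermitianMetric.capacity (h : HermitianMetric E X) : ℝ≥0∞ :=
  ⨆ f ∈ h.moduli, h.packingDensity f

/-- The restriction of a Hermitian metric to an open subset: the pull-back of `h` under the
inclusion. -/
def HermitianMetric.restrict (h : HermitianMetric E X) (U : TopologicalSpace.Opens X) :
    HermitianMetric E U where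
  g x u v := h.g x.1 (mfderiv 𝓘(ℂ, E) 𝓘(ℂ, E) (Subtype.val : U → X) x u)
    (mfderiv 𝓘(ℂ, E) 𝓘(ℂ, E) (Subtype.val : U → X) x v)
  symm x u v := h.symm _ _ _
  add_left x u u' v := by rw [map_add]; exact h.add_left _ _ _ _
  smul_left x c u v := by rw [map_smul]; exact h.smul_left _ _ _ _
  pos x u hu := h.pos _ _ (by rw [mfderiv_opens_val]; exact hu)
  compatible x u v := by rw [map_smul, map_smul]; exact h.compatible _ _ _
  smooth := by
    intro e he u v
    have hU : Nonempty U := by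
      obtain ⟨_, ⟨x, _⟩, _⟩ := he
      exact ⟨x⟩
    obtain ⟨x, rfl⟩ := TopologicalSpace.Opens.chart_eq hU he
    set c := chartAt E x.1 with hc
    have hsub : (c.subtypeRestr ⟨x⟩).target ⊆ c.target := c.subtypeRestr_target_subset ⟨x⟩
    refine ((h.smooth c (chart_mem_atlas E x.1) u v).mono hsub).congr fun y hy ↦ ?_
    have hev : (Subtype.val ∘ (c.subtypeRestr ⟨x⟩).symm) =ᶠ[𝓝 y] c.symm :=
      eventuallyEq_of_mem ((c.subtypeRestr ⟨x⟩).open_target.mem_nhds hy)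
        (c.subtypeRestr_symm_eqOn ⟨x⟩).symm
    have hd : MDifferentiableAt 𝓘(ℂ, E) 𝓘(ℂ, E) (c.subtypeRestr ⟨x⟩).symm y :=
      mdifferentiableAt_atlas_symm he hy
    have hval : MDifferentiableAt 𝓘(ℂ, E) 𝓘(ℂ, E) (Subtype.val : U → X)
        ((c.subtypeRestr ⟨x⟩).symm y) :=
      (contMDiff_subtype_val (n := 1)).mdifferentiableAt (by simp)
    have hcomp : ∀ w : E, (mfderiv 𝓘(ℂ, E) 𝓘(ℂ, E) (Subtype.val : U → X)
        ((c.subtypeRestr ⟨x⟩).symm y) (mfderiv 𝓘(ℂ, E) 𝓘(ℂ, E) (c.subtypeRestr ⟨x⟩).symm y w) : E) =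
          (mfderiv 𝓘(ℂ, E) 𝓘(ℂ, E) c.symm y w : E) := by
      intro w
      have h1 := mfderiv_comp_apply y hval hd w
      rw [hev.mfderiv_eq] at h1
      exact h1.symm
    have hpt : ∀ (p q : X) (_ : p = q) (a b : E), h.g p a b = h.g q a b := by
      rintro p _ rfl a b; rfl
    refine (hpt _ _ hev.eq_of_nhds _ _).trans ?_
    exact congrArg₂ (fun a b : E ↦ h.g (c.symm y) a b) (hcomp u) (hcomp v)

end Capacity

/-! ### The complex projective line -/

/-- The complex projective line. -/
abbrev CP1 : Type := ℙ ℂ (Fin 2 → ℂ)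

namespace CP1

/-- The quotient topology. -/
instance : TopologicalSpace CP1 :=
  TopologicalSpace.coinduced (Projectivization.mk' ℂ (V := Fin 2 → ℂ)) inferInstance

theorem isQuotientMap_mk : IsQuotientMap (Projectivization.mk' ℂ (V := Fin 2 → ℂ)) :=
  ⟨⟨rfl⟩, Quotient.mk''_surjective⟩

/-- The set of `[z₀ : z₁]` with `z_i ≠ 0`. -/
def affineSet (i : Fin 2) : Set CP1 :=
  {p | Projectivization.lift (fun v : {v : Fin 2 → ℂ // v ≠ 0} ↦ v.1 i ≠ 0)
    (by
      rintro ⟨a, ha⟩ ⟨b, hb⟩ t h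
      obtain rfl : a = t • b := h
      have ht : t ≠ 0 := by rintro rfl; simp at ha
      simp [ht]) p}

/-- The coordinate `z_j / z_i` of `[z₀ : z₁]`, where `j ≠ i`. -/
def affineCoord (i : Fin 2) : CP1 → ℂ :=
  Projectivization.lift (fun v : {v : Fin 2 → ℂ // v ≠ 0} ↦ v.1 i.rev / v.1 i)
    (by
      rintro ⟨a, ha⟩ ⟨b, hb⟩ t h
      obtain rfl : a = t • b := h
      have ht : t ≠ 0 := by rintro rfl; simp at ha
      simp [mul_div_mul_left _ _ ht])

/-- The vector with `i`-th coordinate `1` and other coordinate `z`. -/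
def affineVec (i : Fin 2) (z : ℂ) : Fin 2 → ℂ := fun j ↦ if j = i then 1 else z

theorem affineVec_ne_zero (i : Fin 2) (z : ℂ) : affineVec i z ≠ 0 := by
  intro h
  simpa [affineVec] using congrFun h i

/-- The affine chart `[z₀ : z₁] ↦ z_j / z_i`, `j ≠ i`, on the set where `z_i ≠ 0`. -/
def affineChart (i : Fin 2) : OpenPartialHomeomorph CP1 ℂ where
  toFun := affineCoord i
  invFun z := Projectivization.mk ℂ (affineVec i z) (affineVec_ne_zero i z)
  source := affineSet i
  target := univ
  map_source' _ _ := mem_univ _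
  map_target' z _ := by simp [affineSet, affineVec]
  left_inv' p hp := by
    induction p using Projectivization.ind with
    | h v hv =>
      replace hp : v i ≠ 0 := hp
      rw [Projectivization.mk_eq_mk_iff']
      refine ⟨(v i)⁻¹, ?_⟩
      ext j
      by_cases h : j = i
      · subst h; simp [affineVec, hp]
      · have : j = i.rev := by clear hp hv; clear v; decide +revert
        simp [affineVec, h, affineCoord, ← this, div_eq_inv_mul]
  right_inv' z _ := by
    have : i.rev ≠ i := by decide +revert
    simp [affineCoord, affineVec, this]
  open_source := by
    rw [← isQuotientMap_mk.isOpen_preimage]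
    change IsOpen {v : {v : Fin 2 → ℂ // v ≠ 0} | v.1 i ≠ 0}
    exact isOpen_ne_fun ((continuous_apply i).comp continuous_subtype_val) continuous_const
  open_target := isOpen_univ
  continuousOn_toFun := by
    have ho : IsOpen (affineSet i) := by
      rw [← isQuotientMap_mk.isOpen_preimage]
      change IsOpen {v : {v : Fin 2 → ℂ // v ≠ 0} | v.1 i ≠ 0}
      exact isOpen_ne_fun ((continuous_apply i).comp continuous_subtype_val) continuous_const
    rw [isQuotientMap_mk.continuousOn_isOpen_iff ho]
    change ContinuousOn (fun v : {v : Fin 2 → ℂ // v ≠ 0} ↦ v.1 i.rev / v.1 i)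
      {v : {v : Fin 2 → ℂ // v ≠ 0} | v.1 i ≠ 0}
    exact ContinuousOn.div ((continuous_apply i.rev).comp continuous_subtype_val).continuousOn
      ((continuous_apply i).comp continuous_subtype_val).continuousOn fun v hv ↦ hv
  continuousOn_invFun := by
    refine (Continuous.comp (g := Projectivization.mk' ℂ (V := Fin 2 → ℂ))
      (f := fun z ↦ ⟨affineVec i z, affineVec_ne_zero i z⟩)
      isQuotientMap_mk.continuous ?_).continuousOn
    refine Continuous.subtype_mk (continuous_pi fun j ↦ ?_) _
    unfold affineVec
    split_ifs <;> fun_prop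

theorem mem_affineSet_one {p : CP1} (hp : p ∉ affineSet 0) : p ∈ affineSet 1 := by
  induction p using Projectivization.ind with
  | h v hv =>
    replace hp : ¬ (v 0 ≠ 0) := hp
    intro h
    refine hv (funext fun j ↦ ?_)
    fin_cases j
    · simpa using hp
    · exact h

open Classical in
/-- The complex structure given by the two affine charts. -/
instance : ChartedSpace ℂ CP1 where
  atlas := range affineChart
  chartAt p := if p ∈ affineSet 0 then affineChart 0 else affineChart 1
  mem_chart_source p := by
    split_ifs with h
    · exact h
    · exact mem_affineSet_one h
  chart_mem_atlas p := by split_ifs <;> exact mem_range_self _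

theorem affineChart_trans {i j : Fin 2} (hij : i ≠ j) (z : ℂ) :
    affineChart j ((affineChart i).symm z) = z⁻¹ := by
  change affineVec i z j.rev / affineVec i z j = z⁻¹
  have h1 : j.rev = i := by decide +revert
  simp [affineVec, h1, hij.symm]

theorem symm_mem_source_iff {i j : Fin 2} (hij : i ≠ j) (z : ℂ) :
    (affineChart i).symm z ∈ (affineChart j).source ↔ z ≠ 0 := by
  change affineVec i z j ≠ 0 ↔ z ≠ 0
  simp [affineVec, hij.symm]

instance : IsManifold 𝓘(ℂ) ω CP1 := by
  apply isManifold_of_contDiffOn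
  rintro _ _ ⟨i, rfl⟩ ⟨j, rfl⟩
  by_cases hij : i = j
  · subst hij
    refine contDiffOn_id.congr fun z hz ↦ ?_
    exact (affineChart i).right_inv (mem_univ z)
  · have h : ∀ z ∈ (𝓘(ℂ).symm ⁻¹' ((affineChart i).symm ≫ₕ affineChart j).source ∩
        range 𝓘(ℂ)), z ≠ 0 := fun z hz ↦ (symm_mem_source_iff hij z).1 hz.1.2
    refine ContDiffOn.congr (f := fun z : ℂ ↦ z⁻¹) (fun z hz ↦ ?_) fun z hz ↦ ?_
    · exact (contDiffAt_inv ℂ (h z hz)).contDiffWithinAt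
    · exact affineChart_trans hij z

instance : T1Space CP1 := by
  refine ⟨fun p ↦ ?_⟩
  induction p using Projectivization.ind with
  | h w hw =>
    rw [← isQuotientMap_mk.isClosed_preimage]
    have : Projectivization.mk' ℂ ⁻¹' {Projectivization.mk ℂ w hw} =
        {v : {v : Fin 2 → ℂ // v ≠ 0} | v.1 0 * w 1 = v.1 1 * w 0} := by
      ext ⟨v, hv⟩
      simp only [mem_preimage, mem_singleton_iff, Projectivization.mk'_eq_mk, mem_ofPred_eq,
        Projectivization.mk_eq_mk_iff']
      constructor
      · rintro ⟨a, rfl⟩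
        simp; ring
      · intro h
        by_cases h0 : w 0 = 0
        · have h1 : w 1 ≠ 0 := fun h1 ↦ hw (by ext j; fin_cases j <;> simp [h0, h1])
          have hv0 : v 0 = 0 := by simpa [h0, h1] using h
          refine ⟨v 1 / w 1, ?_⟩
          ext j
          fin_cases j
          · simp [h0, hv0]
          · simp [h1]
        · refine ⟨v 0 / w 0, ?_⟩
          ext j
          fin_cases j
          · simp [h0]
          · simp only [Fin.mk_one, Pi.smul_apply, smul_eq_mul]
            field_simp
            rw [h]; ring
    rw [this]
    exact isClosed_eq
      (((continuous_apply 0).comp continuous_subtype_val).mul continuous_const)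
      (((continuous_apply 1).comp continuous_subtype_val).mul continuous_const)

/-- The coefficient `g_{1\bar 1} = (1 / (2π)) ∂²/∂z∂\bar z log (1 + |z|²)` of the Fubini-Study form
`√-1 g_{1\bar 1} dz ∧ d\bar z` in an affine coordinate `z`; here `∂²/∂z∂\bar z = Δ / 4`. -/
def fubiniStudyCoeff (z : ℂ) : ℝ :=
  1 / (2 * Real.pi) * (1 / 4 * (Δ fun w : ℂ ↦ Real.log (1 + ‖w‖ ^ 2)) z)

theorem fubiniStudyCoeff_eq (z : ℂ) :
    fubiniStudyCoeff z = 1 / (2 * Real.pi * (1 + ‖z‖ ^ 2) ^ 2) := by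
  have hpos : ∀ w : ℂ, 1 + ‖w‖ ^ 2 ≠ 0 := fun w ↦ by positivity
  have h1 : ∀ w : ℂ, HasFDerivAt (fun w : ℂ ↦ Real.log (1 + ‖w‖ ^ 2))
      ((2 * (1 + ‖w‖ ^ 2)⁻¹) • innerSL ℝ w) w := fun w ↦ by
    have h := (((hasStrictFDerivAt_norm_sq w).hasFDerivAt).const_add 1).log (hpos w)
    refine h.congr_fderiv ?_
    ext v
    simp
    ring
  have h2 : fderiv ℝ (fun w : ℂ ↦ Real.log (1 + ‖w‖ ^ 2)) =
      fun w ↦ (2 * (1 + ‖w‖ ^ 2)⁻¹) • innerSL ℝ w := funext fun w ↦ (h1 w).fderiv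
  have h3 : HasFDerivAt (fun w : ℂ ↦ 2 * (1 + ‖w‖ ^ 2)⁻¹)
      ((-(4 * ((1 + ‖z‖ ^ 2) ^ 2)⁻¹)) • innerSL ℝ z) z := by
    have h := ((hasDerivAt_inv (hpos z)).comp_hasFDerivAt z
      (((hasStrictFDerivAt_norm_sq z).hasFDerivAt).const_add 1)).const_mul 2
    refine h.congr_fderiv ?_
    ext v
    simp
    ring
  have h4 := h3.smul ((innerSL ℝ (E := ℂ)).hasFDerivAt (x := z))
  have h5 : ‖z‖ ^ 2 = z.re ^ 2 + z.im ^ 2 := by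
    rw [← Complex.normSq_eq_norm_sq, Complex.normSq_apply]; ring
  have h6 : 1 + (z.re ^ 2 + z.im ^ 2) ≠ 0 := by positivity
  rw [fubiniStudyCoeff, InnerProductSpace.laplacian_eq_iteratedFDeriv_complexPlane]
  simp only [iteratedFDeriv_two_apply, h2]
  have h7 : fderiv ℝ (fun w : ℂ ↦ (2 * (1 + ‖w‖ ^ 2)⁻¹) • innerSL ℝ w) z = _ := h4.fderiv
  rw [h7]
  have h8 : ∀ a b : ℂ, innerSL ℝ a b = a.re * b.re + a.im * b.im := fun a b ↦ by
    simp [Complex.inner]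
    ring
  simp only [h5, h8, add_apply, smul_apply,
    ContinuousLinearMap.smulRight_apply, Matrix.cons_val_zero, Matrix.cons_val_one, smul_eq_mul,
    Complex.one_re, Complex.one_im, Complex.I_re, Complex.I_im]
  field_simp
  ring

/-- The Riemannian metric of the Fubini-Study form. The tangent space at `p` is identified with `ℂ`
through the affine chart `chartAt ℂ p`, and `g(u, v) = 2 g_{1\bar 1} Re (u \bar v)` there. -/
def fubiniStudyInner (p : CP1) (u v : ℂ) : ℝ :=
  2 * fubiniStudyCoeff (chartAt ℂ p p) * (u * conj v).re

/-- The same formula holds in both affine charts, on all of their domains. -/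
theorem fubiniStudyInner_chart (i : Fin 2) (y u v : ℂ) :
    fubiniStudyInner ((affineChart i).symm y) (mfderiv 𝓘(ℂ) 𝓘(ℂ) (affineChart i).symm y u)
      (mfderiv 𝓘(ℂ) 𝓘(ℂ) (affineChart i).symm y v) = 2 * fubiniStudyCoeff y * (u * conj v).re := by
  have hd : MDifferentiableAt 𝓘(ℂ) 𝓘(ℂ) (affineChart i).symm y :=
    mdifferentiableAt_atlas_symm (mem_range_self i) (mem_univ y)
  set p := (affineChart i).symm y with hp
  obtain ⟨j, hj⟩ : chartAt ℂ p ∈ range affineChart := chart_mem_atlas ℂ p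
  have hpj : p ∈ (affineChart j).source := hj ▸ mem_chart_source ℂ p
  have hm : ∀ w : ℂ, (mfderiv 𝓘(ℂ) 𝓘(ℂ) (affineChart i).symm y w : ℂ) =
      fderiv ℂ (fun z ↦ affineChart j ((affineChart i).symm z)) y w := by
    intro w
    rw [hd.mfderiv]
    have : writtenInExtChartAt 𝓘(ℂ) 𝓘(ℂ) y (affineChart i).symm =
        fun z ↦ chartAt ℂ p ((affineChart i).symm z) := rfl
    rw [this, ← hj]
    change (fderivWithin ℂ (fun z ↦ affineChart j ((affineChart i).symm z)) (range (id : ℂ → ℂ)) y)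
      w = _
    rw [range_id, fderivWithin_univ]
  refine (congrArg₂ (fubiniStudyInner p) (hm u) (hm v)).trans ?_
  rw [fubiniStudyInner, ← hj]
  by_cases hij : i = j
  · subst hij
    have h1 : (fun z ↦ affineChart i ((affineChart i).symm z)) = id :=
      funext fun z ↦ (affineChart i).right_inv (mem_univ z)
    rw [h1, hp, (affineChart i).right_inv (mem_univ y)]
    simp
  · have h1 : (fun z ↦ affineChart j ((affineChart i).symm z)) = fun z ↦ z⁻¹ :=
      funext fun z ↦ affineChart_trans hij z
    have hy : y ≠ 0 := (symm_mem_source_iff hij y).1 hpj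
    have hn : ‖y‖ ≠ 0 := norm_ne_zero_iff.2 hy
    rw [h1, hp, affineChart_trans hij, (hasFDerivAt_inv hy).fderiv, fubiniStudyCoeff_eq,
      fubiniStudyCoeff_eq]
    have h2 : ∀ c : ℂ, (u * c * conj (v * c)).re = ‖c‖ ^ 2 * (u * conj v).re := fun c ↦ by
      have : u * c * conj (v * c) = (‖c‖ ^ 2 : ℝ) * (u * conj v) := by
        rw [map_mul, Complex.ofReal_pow, ← Complex.mul_conj']; ring
      rw [this, Complex.re_ofReal_mul]
    simp only [smul_eq_mul,
      ContinuousLinearMap.toSpanSingleton_apply]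
    rw [h2]
    simp only [norm_neg, norm_inv, norm_pow]
    field_simp
    ring

/-- The Fubini-Study metric on the complex projective line. -/
def fubiniStudy : HermitianMetric ℂ CP1 where
  g := fubiniStudyInner
  symm p u v := by
    have h : ∀ u v : ℂ, fubiniStudyInner p u v = fubiniStudyInner p v u := fun u v ↦ by
      simp only [fubiniStudyInner, Complex.mul_re, Complex.conj_re, Complex.conj_im]
      ring
    exact h u v
  add_left p u u' v := by
    have h : ∀ u u' v : ℂ, fubiniStudyInner p (u + u') v =
        fubiniStudyInner p u v + fubiniStudyInner p u' v := fun u u' v ↦ by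
      simp only [fubiniStudyInner, add_mul, Complex.add_re, mul_add]
    exact h u u' v
  smul_left p c u v := by
    have h : ∀ u v : ℂ, fubiniStudyInner p ((c : ℂ) • u) v = c * fubiniStudyInner p u v :=
      fun u v ↦ by
        simp only [fubiniStudyInner, smul_eq_mul, mul_assoc, Complex.re_ofReal_mul]
        ring
    exact h u v
  pos p u hu := by
    have h : ∀ u : ℂ, u ≠ 0 → 0 < fubiniStudyInner p u u := fun u hu ↦ by
      have h0 : 0 < ‖u‖ := norm_pos_iff.2 hu
      rw [fubiniStudyInner, fubiniStudyCoeff_eq, Complex.mul_conj', ← Complex.ofReal_pow,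
        Complex.ofReal_re]
      positivity
    exact h u hu
  compatible p u v := by
    have h : ∀ u v : ℂ, fubiniStudyInner p (Complex.I • u) (Complex.I • v) =
        fubiniStudyInner p u v := fun u v ↦ by
      simp [fubiniStudyInner]
    exact h u v
  smooth := by
    rintro _ ⟨i, rfl⟩ u v
    simp only [fubiniStudyInner_chart, fubiniStudyCoeff_eq]
    refine ContDiff.contDiffOn ?_
    refine ContDiff.mul (contDiff_const.mul (contDiff_const.div ?_ ?_)) contDiff_const
    · exact contDiff_const.mul ((contDiff_const.add (contDiff_norm_sq ℝ)).pow 2)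
    · intro x; positivity

/-- The open subset of the complex projective line obtained by removing two points. -/
def complPair (w₁ w₂ : CP1) : TopologicalSpace.Opens CP1 :=
  ⟨{w₁, w₂}ᶜ, (Set.toFinite _).isClosed.isOpen_compl⟩

end CP1

end

/-! A fractional linear map sending the two omitted points to `0` and `∞` distorts the Fubini–Study
metric by a bounded factor. A curve `f` with `|df| ≤ 1` that avoids both points therefore becomes a
zero-free entire function `g = exp h` with bounded spherical derivative
(`exists_entire_comparable`). That derivative equals `|h'| / (2 cosh (Re h))`, so `|h'| ≤ C cosh (Re
h)` for some constant `C`.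

Such an `h` is affine (`exists_eq_affine_of_norm_deriv_le_cosh`). On the set `Re h = 0` the bound
reads `|h'| ≤ C`. If `Re h(z) > 0` and `p` is a nearest point of that set, at distance `r`, then `Re
h` is positive on the disc of radius `r` about `z`. Harnack's inequality, applied along the radius
ending at `p`, gives `Re h(z) ≤ 2 r |h'(p)|`, and the Schwarz lemma gives `|h'(z)| ≤ 2 Re h(z) / r`.
Hence `|h'| ≤ 4C` everywhere, and Liouville's theorem makes `h'` constant.

So `|df|` is at most a multiple of `|c| / cosh (Re (cz + d))`. It is zero if `c = 0`; otherwise it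
is concentrated near a line, and the energy in a disc of radius `R` is `O(R)`, negligible against `π
R²`. -/

/-! ### Holomorphic functions with positive real part -/

/-- The Schwarz lemma applied to the Cayley transform of a function with positive real part. -/
theorem exists_cayley_bounds {h : ℂ → ℂ} (hh : Differentiable ℂ h) {z : ℂ} {d : ℝ} (hd : 0 < d)
    (hpos : ∀ w ∈ Metric.ball z d, 0 < (h w).re) :
    ‖deriv h z‖ ≤ 2 * (h z).re / d ∧
      ∀ w ∈ Metric.ball z d, ‖h w - h z‖ ≤ 1 / d * dist w z * ‖h w + conj (h z)‖ := by
  have hz : 0 < (h z).re := hpos z (Metric.mem_ball_self hd)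
  have hne : ∀ w ∈ Metric.ball z d, h w + conj (h z) ≠ 0 := fun w hw h0 ↦ by
    have := congrArg Complex.re h0
    simp only [Complex.add_re, Complex.conj_re, Complex.zero_re] at this
    linarith [hpos w hw]
  set φ : ℂ → ℂ := fun w ↦ (h w - h z) / (h w + conj (h z)) with hφ
  have hφz : φ z = 0 := by simp [hφ]
  have hφd : DifferentiableOn ℂ φ (Metric.ball z d) :=
    (hh.sub_const _).differentiableOn.div (hh.add_const _).differentiableOn hne
  have hmaps : MapsTo φ (Metric.ball z d) (Metric.closedBall (φ z) 1) := fun w hw ↦ by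
    rw [hφz, mem_closedBall_zero_iff, norm_div]
    refine div_le_one_of_le₀ (abs_le_of_sq_le_sq' ?_ (norm_nonneg _)).2 (norm_nonneg _)
    rw [← Complex.normSq_eq_norm_sq, ← Complex.normSq_eq_norm_sq, Complex.normSq_apply,
      Complex.normSq_apply]
    simp only [Complex.add_re, Complex.sub_re, Complex.add_im, Complex.sub_im, Complex.conj_re,
      Complex.conj_im]
    -- The squared norms of denominator and numerator differ by `4 Re h(z) Re h(w) > 0`.
    nlinarith [mul_pos hz (hpos w hw)]
  constructor
  · have h1 := Complex.norm_deriv_le_div_of_mapsTo_ball hφd hmaps hd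
    have h2 : HasDerivAt φ (deriv h z / (2 * (h z).re : ℝ)) z := by
      refine (((hh z).hasDerivAt.sub_const (h z)).div ((hh z).hasDerivAt.add_const (conj (h z)))
        (hne z (Metric.mem_ball_self hd))).congr_deriv ?_
      have h3 := hne z (Metric.mem_ball_self hd)
      rw [Complex.add_conj] at h3 ⊢
      have h4 : ((h z).re : ℂ) ≠ 0 := by exact_mod_cast hz.ne'
      push_cast
      field_simp
      ring
    rw [h2.deriv, norm_div, Complex.norm_real, Real.norm_of_nonneg (by positivity),
      div_le_iff₀ (by positivity)] at h1
    exact h1.trans_eq (by ring)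
  · intro w hw
    have h1 := Complex.dist_le_div_mul_dist_of_mapsTo_ball hφd hmaps hw
    rwa [hφz, dist_zero_right, norm_div, div_le_iff₀ (norm_pos_iff.2 (hne w hw))] at h1

/-- Harnack's inequality (lower bound). -/
theorem harnack_lower {h : ℂ → ℂ} (hh : Differentiable ℂ h) {z : ℂ} {d : ℝ} (hd : 0 < d)
    (hpos : ∀ w ∈ Metric.ball z d, 0 < (h w).re) {w : ℂ} (hw : w ∈ Metric.ball z d) :
    (h z).re * (d - dist w z) ≤ (h w).re * (d + dist w z) := by
  have hz : 0 < (h z).re := hpos z (Metric.mem_ball_self hd)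
  have hw0 := hpos w hw
  have h1 := (exists_cayley_bounds hh hd hpos).2 w hw
  have hwd : dist w z < d := hw
  have hr0 : 0 ≤ dist w z := dist_nonneg
  set δ := dist w z
  have h2 : d * ‖h w - h z‖ ≤ δ * ‖h w + conj (h z)‖ := by
    calc d * ‖h w - h z‖ ≤ d * (1 / d * δ * ‖h w + conj (h z)‖) := by gcongr
      _ = _ := by field_simp
  have h3 : d ^ 2 * ‖h w - h z‖ ^ 2 ≤ δ ^ 2 * ‖h w + conj (h z)‖ ^ 2 := by
    rw [← mul_pow, ← mul_pow]; gcongr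
  rw [← Complex.normSq_eq_norm_sq, ← Complex.normSq_eq_norm_sq, Complex.normSq_apply,
    Complex.normSq_apply] at h3
  simp only [Complex.add_re, Complex.sub_re, Complex.add_im, Complex.sub_im, Complex.conj_re,
    Complex.conj_im] at h3
  -- Both sides of `h3` contain the same imaginary part, `Im h(w) - Im h(z)`; since `δ < d`, it can
  -- be discarded.
  have h4 : (d * ((h z).re - (h w).re)) ^ 2 ≤ (δ * ((h w).re + (h z).re)) ^ 2 := by
    have h5 : δ ^ 2 * ((h w).im - (h z).im) ^ 2 ≤ d ^ 2 * ((h w).im - (h z).im) ^ 2 := by gcongr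
    nlinarith
  have h6 := (abs_le_of_sq_le_sq' h4 (by positivity)).2
  linarith

/-! ### Entire functions with `|h'| ≤ C cosh (Re h)` -/

/-- If the real part is positive on a disc and vanishes at a boundary point, then the derivative at
that point controls the value at the centre. -/
theorem re_le_of_re_eq_zero_boundary {h : ℂ → ℂ} (hh : Differentiable ℂ h) {z p : ℂ}
    (hzp : z ≠ p) (hpos : ∀ w ∈ Metric.ball z (dist z p), 0 < (h w).re) (hp : (h p).re = 0) :
    (h z).re ≤ 2 * (dist z p * ‖deriv h p‖) := by
  have hd : 0 < dist z p := dist_pos.2 hzp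
  have hz : 0 < (h z).re := hpos z (Metric.mem_ball_self hd)
  have h1 : HasDerivAt (fun s : ℝ ↦ p + (s : ℂ) * (z - p)) (z - p) 0 := by
    simpa using (((Complex.ofRealCLM.hasDerivAt (x := (0 : ℝ))).mul_const (z - p)).const_add p)
  have h2 : HasDerivAt (fun s : ℝ ↦ h (p + (s : ℂ) * (z - p))) (deriv h p * (z - p)) 0 := by
    have h3 : HasDerivAt h (deriv h p) (p + ((0 : ℝ) : ℂ) * (z - p)) := by
      simpa using (hh p).hasDerivAt
    exact h3.comp (0 : ℝ) h1
  have h3 : HasDerivAt (fun s : ℝ ↦ (h (p + (s : ℂ) * (z - p))).re)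
      (deriv h p * (z - p)).re 0 := by
    have := Complex.reCLM.hasFDerivAt.comp_hasDerivAt (0 : ℝ) h2
    simpa [Function.comp_def] using this
  -- On the segment from `p` to `z`, Harnack bounds the difference quotient of `Re h` at `p` below
  -- by `Re h(z) / (2 - s)`, hence by `Re h(z) / 2`; then `s → 0+`.
  have h4 : (h z).re / 2 ≤ (deriv h p * (z - p)).re := by
    refine ge_of_tendsto h3.tendsto_slope_zero_right ?_
    filter_upwards [Ioo_mem_nhdsGT (zero_lt_one (α := ℝ))] with s hs
    have hdist : dist (p + (s : ℂ) * (z - p)) z = (1 - s) * dist z p := by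
      have : p + (s : ℂ) * (z - p) - z = -(((1 - s : ℝ) : ℂ) * (z - p)) := by push_cast; ring
      rw [dist_eq_norm, this, norm_neg, norm_mul, Complex.norm_real,
        Real.norm_of_nonneg (by linarith [hs.2]), dist_eq_norm]
    have hmem : p + (s : ℂ) * (z - p) ∈ Metric.ball z (dist z p) := by
      rw [Metric.mem_ball, hdist]; nlinarith [hs.1]
    have h5 := harnack_lower hh hd hpos hmem
    have h6 := hpos _ hmem
    rw [hdist] at h5
    simp only [zero_add, smul_eq_mul, Complex.ofReal_zero, zero_mul, add_zero, hp, sub_zero]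
    rw [← div_eq_inv_mul, le_div_iff₀ hs.1]
    have h7 : (h z).re * s ≤ (h (p + (s : ℂ) * (z - p))).re * (2 - s) := by
      refine le_of_mul_le_mul_right ?_ hd
      linarith
    nlinarith [mul_pos h6 hs.1]
  have h5 : (deriv h p * (z - p)).re ≤ ‖deriv h p‖ * dist z p := by
    rw [dist_eq_norm, ← norm_mul]; exact Complex.re_le_norm _
  linarith

/-- A function whose real part has no zeros on a disc around a point where it is positive has
positive real part on the disc. -/
theorem re_pos_of_ne_zero {h : ℂ → ℂ} (hh : Continuous h) {z : ℂ} {d : ℝ} (hz : 0 < (h z).re)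
    (hne : ∀ w ∈ Metric.ball z d, (h w).re ≠ 0) : ∀ w ∈ Metric.ball z d, 0 < (h w).re := by
  intro w hw
  by_contra! hcon
  have hd : 0 < d := dist_nonneg.trans_lt hw
  obtain ⟨x, hx, hx0⟩ := (convex_ball z d).isPreconnected.intermediate_value hw
    (Metric.mem_ball_self hd) (Complex.continuous_re.comp hh).continuousOn ⟨hcon, hz.le⟩
  exact hne x hx hx0

/-- The estimate at a nearest zero of `Re h` carries the bound on the zero set over to `z`. The
second alternative covers the case where `Re h` never vanishes: there `hC` is vacuous and gives no
sign for `C`. -/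
theorem norm_deriv_le_of_re_pos {h : ℂ → ℂ} (hh : Differentiable ℂ h) {C : ℝ}
    (hC : ∀ w, (h w).re = 0 → ‖deriv h w‖ ≤ C) {z : ℂ} (hz : 0 < (h z).re) :
    ‖deriv h z‖ ≤ 4 * C ∨ deriv h z = 0 := by
  set S : Set ℂ := {w | (h w).re = 0} with hS
  rcases S.eq_empty_or_nonempty with hSe | hSn
  · right
    -- With no zeros, the Schwarz bound is available on discs of every radius.
    have h1 : ∀ d : ℝ, 0 < d → ‖deriv h z‖ ≤ 2 * (h z).re / d := fun d hd ↦
      (exists_cayley_bounds hh hd (re_pos_of_ne_zero hh.continuous hz fun w _ hw ↦ by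
        have : w ∈ S := hw
        simp [hSe] at this)).1
    have h2 : Tendsto (fun d : ℝ ↦ 2 * (h z).re / d) atTop (𝓝 0) :=
      tendsto_const_nhds.div_atTop tendsto_id
    have h3 : ‖deriv h z‖ ≤ 0 := ge_of_tendsto h2 ((eventually_gt_atTop 0).mono h1)
    exact norm_le_zero_iff.1 h3
  · left
    have hcl : IsClosed S :=
      isClosed_eq (Complex.continuous_re.comp hh.continuous) continuous_const
    obtain ⟨p, hpS, hp⟩ := hcl.exists_infDist_eq_dist hSn z
    have hzp : z ≠ p := by rintro rfl; exact hz.ne' hpS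
    have hd : 0 < dist z p := dist_pos.2 hzp
    have hpos : ∀ w ∈ Metric.ball z (dist z p), 0 < (h w).re := by
      refine re_pos_of_ne_zero hh.continuous hz fun w hw hw0 ↦ ?_
      have h1 := Metric.infDist_le_dist_of_mem (x := z) (show w ∈ S from hw0)
      rw [hp, dist_comm z w] at h1
      exact absurd hw (not_lt.2 h1)
    have h1 := (exists_cayley_bounds hh hd hpos).1
    have h2 := re_le_of_re_eq_zero_boundary hh hzp hpos hpS
    have h3 := hC p hpS
    -- The radius cancels: `2 Re h(z) / r ≤ 2 (2 r C) / r = 4C`, where `r = dist z p`.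
    refine h1.trans ?_
    rw [div_le_iff₀ hd]
    nlinarith [mul_le_mul_of_nonneg_left h3 hd.le]

/-- The hypothesis is used only where `Re h = 0`, since there `cosh = 1`. Applying the half-plane
estimate to `h` and to `-h` bounds `h'` on the whole plane, and Liouville's theorem applies to `h'`.
-/
theorem exists_eq_affine_of_norm_deriv_le_cosh {h : ℂ → ℂ} (hh : Differentiable ℂ h) {C : ℝ}
    (hC : ∀ z, ‖deriv h z‖ ≤ C * Real.cosh (h z).re) : ∃ c d : ℂ, ∀ z, h z = c * z + d := by
  have hC0 : ∀ w, (h w).re = 0 → ‖deriv h w‖ ≤ C := fun w hw ↦ by simpa [hw] using hC w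
  have hCnn : 0 ≤ C :=
    nonneg_of_mul_nonneg_left ((norm_nonneg _).trans (hC 0)) (Real.cosh_pos _)
  have hpos : ∀ {g : ℂ → ℂ} (_ : Differentiable ℂ g)
      (_ : ∀ w, (g w).re = 0 → ‖deriv g w‖ ≤ C) (z : ℂ), 0 < (g z).re → ‖deriv g z‖ ≤ 4 * C := by
    intro g hg hgC z hz
    rcases norm_deriv_le_of_re_pos hg hgC hz with h1 | h1
    · exact h1
    · rw [h1, norm_zero]; positivity
  have hb : ∀ z, ‖deriv h z‖ ≤ 4 * C := by
    intro z
    rcases lt_trichotomy (h z).re 0 with hz | hz | hz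
    · have h1 := hpos hh.neg (fun w hw ↦ by
        have hw' : (h w).re = 0 := by simpa using hw
        rw [deriv.neg, norm_neg]; exact hC0 w hw') z (by simpa using hz)
      rwa [deriv.neg, norm_neg] at h1
    · linarith [hC0 z hz]
    · exact hpos hh hC0 z hz
  have hdd : Differentiable ℂ (deriv h) := fun z ↦ ((hh.analyticAt z).deriv).differentiableAt
  obtain ⟨c, hc⟩ := hdd.exists_const_forall_eq_of_bounded
    (isBounded_iff_forall_norm_le.2 ⟨4 * C, by rintro _ ⟨z, rfl⟩; exact hb z⟩)
  refine ⟨c, h 0, fun z ↦ ?_⟩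
  have hk : Differentiable ℂ fun z ↦ h z - c * z := hh.sub (differentiable_id.const_mul c)
  have h1 := is_const_of_deriv_eq_zero hk (fun w ↦ by
    have := (hh w).hasDerivAt.sub ((hasDerivAt_id w).const_mul c)
    refine this.deriv.trans ?_
    simp [hc]) z 0
  simp only [mul_zero, sub_zero] at h1
  rw [← h1]; ring

/-- A nonvanishing entire function has an entire logarithm. -/
theorem exists_eq_exp_of_ne_zero {g : ℂ → ℂ} (hg : Differentiable ℂ g) (hne : ∀ z, g z ≠ 0) :
    ∃ h : ℂ → ℂ, Differentiable ℂ h ∧ ∀ z, g z = Complex.exp (h z) := by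
  have hd : Differentiable ℂ (deriv g) := fun z ↦ ((hg.analyticAt z).deriv).differentiableAt
  obtain ⟨h, h0, hh⟩ := (hd.div hg hne).isExactOn_univ.with_val_at 0 (Complex.log (g 0))
  have hhd : ∀ z, HasDerivAt h (deriv g z / g z) z := fun z ↦ hh z (mem_univ z)
  refine ⟨h, fun z ↦ (hhd z).differentiableAt, fun z ↦ ?_⟩
  have hq : ∀ w, HasDerivAt (fun w ↦ g w * Complex.exp (-h w)) 0 w := fun w ↦ by
    refine ((hg w).hasDerivAt.mul (hhd w).neg.cexp).congr_deriv ?_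
    have := hne w
    field_simp
    ring
  have h1 := is_const_of_deriv_eq_zero (fun w ↦ (hq w).differentiableAt)
    (fun w ↦ (hq w).deriv) z 0
  simp only [h0, Complex.exp_neg, Complex.exp_log (hne 0)] at h1
  rw [mul_inv_cancel₀ (hne 0)] at h1
  exact eq_of_div_eq_one (by rwa [div_eq_mul_inv])

/-- A nonvanishing entire function with bounded spherical derivative is the exponential of an affine
function. -/
theorem exists_eq_exp_affine {g : ℂ → ℂ} (hg : Differentiable ℂ g) (hne : ∀ z, g z ≠ 0) {C : ℝ}
    (hC : ∀ z, ‖deriv g z‖ / (1 + ‖g z‖ ^ 2) ≤ C) :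
    ∃ c d : ℂ, ∀ z, g z = Complex.exp (c * z + d) := by
  obtain ⟨h, hh, hgh⟩ := exists_eq_exp_of_ne_zero hg hne
  have hg' : ∀ z, deriv g z = Complex.exp (h z) * deriv h z := fun z ↦ by
    rw [funext hgh]; exact ((hh z).hasDerivAt.cexp).deriv
  -- With `u = Re h`, `1 + e^(2u) = 2 e^u cosh u`; this is the source of the factor `2`.
  obtain ⟨c, d, hcd⟩ := exists_eq_affine_of_norm_deriv_le_cosh hh (C := 2 * C) fun z ↦ by
    have h1 := hC z
    rw [hg', hgh, norm_mul, Complex.norm_exp, div_le_iff₀ (by positivity)] at h1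
    have h2 : 1 + Real.exp (h z).re ^ 2 = Real.exp (h z).re * (2 * Real.cosh (h z).re) := by
      rw [Real.cosh_eq, Real.exp_neg]
      have := (Real.exp_pos (h z).re).ne'
      field_simp
      ring
    rw [h2] at h1
    refine le_of_mul_le_mul_left (h1.trans_eq ?_) (Real.exp_pos (h z).re)
    ring
  exact ⟨c, d, fun z ↦ by rw [hgh, hcd]⟩

/-! ### Averages over large discs -/

/-- The disc lies in the strip `|Im z| ≤ R`, over which Tonelli's theorem splits the integral. -/
theorem setLIntegral_closedBall_re_le {φ : ℝ → ℝ≥0∞} (hφ : Measurable φ) (R : ℝ) :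
    ∫⁻ z in Metric.closedBall (0 : ℂ) R, φ z.re ≤ (∫⁻ x, φ x) * ENNReal.ofReal (2 * R) := by
  have hsub : Metric.closedBall (0 : ℂ) R ⊆
      Complex.measurableEquivRealProd ⁻¹' (univ ×ˢ Icc (-R) R) := fun z hz ↦ by
    rw [mem_closedBall_zero_iff] at hz
    exact ⟨mem_univ _, abs_le.1 ((Complex.abs_im_le_norm z).trans hz)⟩
  refine (lintegral_mono_set hsub).trans_eq ?_
  have h1 := Complex.volume_preserving_equiv_real_prod.setLIntegral_comp_preimage_emb
    Complex.measurableEquivRealProd.measurableEmbedding (fun p : ℝ × ℝ ↦ φ p.1)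
    (univ ×ˢ Icc (-R) R)
  refine h1.trans ?_
  rw [Measure.volume_eq_prod, ← Measure.prod_restrict, Measure.restrict_univ]
  have h2 := lintegral_prod_mul (μ := (volume : Measure ℝ)) (ν := volume.restrict (Icc (-R) R))
    (f := φ) (g := fun _ ↦ 1) hφ.aemeasurable aemeasurable_const
  simp only [mul_one] at h2
  rw [h2, setLIntegral_one, Real.volume_Icc, sub_neg_eq_add, two_mul]

/-- Discs about `0` are invariant under rotation by the phase of `c`, so only `‖c‖` matters. -/
theorem setLIntegral_closedBall_re_mul (φ : ℝ → ℝ≥0∞) (c : ℂ) (R : ℝ) :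
    ∫⁻ z in Metric.closedBall (0 : ℂ) R, φ (c * z).re =
      ∫⁻ z in Metric.closedBall (0 : ℂ) R, φ (‖c‖ * z.re) := by
  by_cases hc : c = 0
  · simp [hc]
  have hn : ‖c‖ ≠ 0 := norm_ne_zero_iff.2 hc
  let a : Circle := ⟨c / ‖c‖, by simp [Submonoid.unitSphere, hn]⟩
  have h1 := (rotation a).measurePreserving.setLIntegral_comp_preimage_emb
    (rotation a).toHomeomorph.measurableEmbedding (fun z ↦ φ (‖c‖ * z.re))
    (Metric.closedBall (0 : ℂ) R)
  rw [← h1, LinearIsometryEquiv.preimage_closedBall, map_zero]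
  refine lintegral_congr fun z ↦ ?_
  have h2 : c * z = (‖c‖ : ℂ) * rotation a z := by
    rw [rotation_apply]
    change c * z = ‖c‖ * (c / ‖c‖ * z)
    have : (‖c‖ : ℂ) ≠ 0 := by exact_mod_cast hn
    field_simp
  rw [h2, Complex.re_ofReal_mul]

/-- Since `cosh² x = 1 + sinh² x ≥ 1 + x²`, the integrand is dominated by an affine substitution in
`1 / (1 + x²)`. -/
theorem lintegral_inv_cosh_sq_affine_lt_top {a : ℝ} (ha : a ≠ 0) (b : ℝ) :
    ∫⁻ x : ℝ, ENNReal.ofReal ((Real.cosh (a * x + b) ^ 2)⁻¹) < ⊤ := by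
  have h1 : Integrable fun x : ℝ ↦ (1 + (a * x + b) ^ 2)⁻¹ :=
    (integrable_inv_one_add_sq.comp_add_right b).comp_mul_left' ha
  refine lt_of_le_of_lt (lintegral_mono fun x ↦ ENNReal.ofReal_le_ofReal ?_) h1.lintegral_lt_top
  have h2 : (a * x + b) ^ 2 ≤ Real.sinh (a * x + b) ^ 2 := by
    rw [sq_le_sq, Real.abs_sinh]
    exact Real.self_le_sinh_iff.2 (abs_nonneg _)
  rw [Real.cosh_sq']
  gcongr

/-- The average of `1 / cosh² (Re (c z + d))` over a disc tends to zero. -/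
theorem tendsto_average_inv_cosh_sq {c : ℂ} (hc : c ≠ 0) (d : ℂ) :
    Tendsto (fun R : ℝ ↦ (∫⁻ z in Metric.closedBall (0 : ℂ) R,
      ENNReal.ofReal ((Real.cosh (c * z + d).re ^ 2)⁻¹)) / ENNReal.ofReal (Real.pi * R ^ 2))
      atTop (𝓝 0) := by
  set L : ℝ≥0∞ := ∫⁻ x : ℝ, ENNReal.ofReal ((Real.cosh (‖c‖ * x + d.re) ^ 2)⁻¹) with hL
  have hLtop : L ≠ ⊤ := (lintegral_inv_cosh_sq_affine_lt_top (norm_ne_zero_iff.2 hc) _).ne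
  have hle : ∀ R : ℝ, ∫⁻ z in Metric.closedBall (0 : ℂ) R,
      ENNReal.ofReal ((Real.cosh (c * z + d).re ^ 2)⁻¹) ≤ L * ENNReal.ofReal (2 * R) := fun R ↦ by
    simp only [Complex.add_re]
    rw [setLIntegral_closedBall_re_mul
      (fun x ↦ ENNReal.ofReal ((Real.cosh (x + d.re) ^ 2)⁻¹)) c R]
    exact setLIntegral_closedBall_re_le
      (φ := fun x ↦ ENNReal.ofReal ((Real.cosh (‖c‖ * x + d.re) ^ 2)⁻¹))
      (by fun_prop) R
  have hlim : Tendsto (fun R : ℝ ↦ L * ENNReal.ofReal (2 / Real.pi / R)) atTop (𝓝 0) := by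
    have h1 : Tendsto (fun R : ℝ ↦ ENNReal.ofReal (2 / Real.pi / R)) atTop (𝓝 0) := by
      simpa using ENNReal.tendsto_ofReal
        ((tendsto_const_nhds (x := 2 / Real.pi)).div_atTop tendsto_id)
    simpa using ENNReal.Tendsto.const_mul h1 (Or.inr hLtop)
  refine tendsto_of_tendsto_of_tendsto_of_le_of_le' tendsto_const_nhds hlim
    (Eventually.of_forall fun _ ↦ zero_le) ?_
  filter_upwards [eventually_gt_atTop 0] with R hR
  have hpi := Real.pi_pos
  calc _ ≤ L * ENNReal.ofReal (2 * R) / ENNReal.ofReal (Real.pi * R ^ 2) := by gcongr; exact hle R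
    _ = L * ENNReal.ofReal (2 / Real.pi / R) := by
      rw [mul_div_assoc, ← ENNReal.ofReal_div_of_pos (by positivity)]
      congr 2
      field_simp

/-! ### Fractional linear transformations and spherical derivatives -/

/-- The spherical derivative (up to a constant factor) of a meromorphic function. -/
noncomputable def sphericalDeriv (g : ℂ → ℂ) (z : ℂ) : ℝ := ‖deriv g z‖ / (1 + ‖g z‖ ^ 2)

/-- Cauchy–Schwarz in `ℂ²`; row by row it bounds a 2×2 matrix by its Frobenius norm. -/
theorem norm_sub_mul_sq_le (a b x y : ℂ) :
    ‖a * x - b * y‖ ^ 2 ≤ (‖a‖ ^ 2 + ‖b‖ ^ 2) * (‖x‖ ^ 2 + ‖y‖ ^ 2) := by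
  have h1 : ‖a * x - b * y‖ ≤ ‖a‖ * ‖x‖ + ‖b‖ * ‖y‖ := by
    rw [← norm_mul, ← norm_mul]; exact norm_sub_le _ _
  have h2 : ‖a * x - b * y‖ ^ 2 ≤ (‖a‖ * ‖x‖ + ‖b‖ * ‖y‖) ^ 2 := by gcongr
  nlinarith [sq_nonneg (‖a‖ * ‖y‖ - ‖b‖ * ‖x‖)]

/-- A fractional linear transformation changes spherical derivatives by a bounded factor. -/
theorem sphericalDeriv_mobius {F : ℂ → ℂ} {z α β γ δ : ℂ} (hF : DifferentiableAt ℂ F z)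
    (hB : γ * F z + δ ≠ 0) (hD : α * δ - β * γ ≠ 0) {g : ℂ → ℂ}
    (hg : g =ᶠ[𝓝 z] fun w ↦ (α * F w + β) / (γ * F w + δ)) {K : ℝ}
    (hK : K = (‖α‖ ^ 2 + ‖β‖ ^ 2 + ‖γ‖ ^ 2 + ‖δ‖ ^ 2) / ‖α * δ - β * γ‖) :
    DifferentiableAt ℂ g z ∧ sphericalDeriv g z ≤ K * sphericalDeriv F z ∧
      sphericalDeriv F z ≤ K * sphericalDeriv g z := by
  have h1 : HasDerivAt g ((α * δ - β * γ) * deriv F z / (γ * F z + δ) ^ 2) z := by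
    refine HasDerivAt.congr_of_eventuallyEq (((hF.hasDerivAt.const_mul α).add_const β).div
      ((hF.hasDerivAt.const_mul γ).add_const δ) hB |>.congr_deriv ?_) hg
    congr 1
    ring
  refine ⟨h1.differentiableAt, ?_⟩
  set D := α * δ - β * γ
  set A := α * F z + β with hA
  set B := γ * F z + δ with hBdef
  set S := ‖α‖ ^ 2 + ‖β‖ ^ 2 + ‖γ‖ ^ 2 + ‖δ‖ ^ 2 with hS
  have hD0 : 0 < ‖D‖ := norm_pos_iff.2 hD
  have hB0 : 0 < ‖B‖ := norm_pos_iff.2 hB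
  have hgs : sphericalDeriv g z = ‖D‖ * ‖deriv F z‖ / (‖A‖ ^ 2 + ‖B‖ ^ 2) := by
    have hgz : g z = A / B := hg.eq_of_nhds
    rw [sphericalDeriv, h1.deriv, hgz, norm_div, norm_div, norm_mul, norm_pow]
    field_simp
    ring
  have hAB : 0 < ‖A‖ ^ 2 + ‖B‖ ^ 2 := by positivity
  -- The vector `(A, B)` is the coefficient matrix applied to `(F z, 1)`. The adjugate matrix, which
  -- has the same Frobenius norm, sends it back to `D (F z, 1)`.
  have hlow : ‖D‖ ^ 2 * (1 + ‖F z‖ ^ 2) ≤ S * (‖A‖ ^ 2 + ‖B‖ ^ 2) := by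
    have e1 : δ * A - β * B = D * F z := by simp only [hA, hBdef, D]; ring
    have e2 : α * B - γ * A = D := by simp only [hA, hBdef, D]; ring
    have h2 := norm_sub_mul_sq_le δ β A B
    have h3 := norm_sub_mul_sq_le α γ B A
    rw [e1, norm_mul] at h2
    rw [e2] at h3
    rw [hS]
    linarith
  have hup : ‖A‖ ^ 2 + ‖B‖ ^ 2 ≤ S * (1 + ‖F z‖ ^ 2) := by
    have h2 := norm_sub_mul_sq_le α (-β) (F z) 1
    have h3 := norm_sub_mul_sq_le γ (-δ) (F z) 1
    simp only [norm_neg, norm_one, mul_one, sub_neg_eq_add] at h2 h3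
    rw [hS]
    linarith
  rw [hgs, sphericalDeriv, hK]
  constructor
  · rw [div_mul_div_comm, div_le_div_iff₀ hAB (by positivity)]
    calc _ = ‖deriv F z‖ * (‖D‖ ^ 2 * (1 + ‖F z‖ ^ 2)) := by ring
      _ ≤ ‖deriv F z‖ * (S * (‖A‖ ^ 2 + ‖B‖ ^ 2)) := by gcongr
      _ = _ := by ring
  · rw [div_mul_div_comm, div_le_div_iff₀ (by positivity) (by positivity)]
    calc _ = ‖deriv F z‖ * ‖D‖ * (‖A‖ ^ 2 + ‖B‖ ^ 2) := by ring
      _ ≤ ‖deriv F z‖ * ‖D‖ * (S * (1 + ‖F z‖ ^ 2)) := by gcongr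
      _ = _ := by ring

theorem sphericalDeriv_exp_affine {g : ℂ → ℂ} {c d : ℂ}
    (hg : ∀ z, g z = Complex.exp (c * z + d)) (z : ℂ) :
    sphericalDeriv g z = ‖c‖ / 2 * (Real.cosh (c * z + d).re)⁻¹ := by
  have h1 : HasDerivAt g (Complex.exp (c * z + d) * c) z := by
    rw [funext hg]
    simpa using (((hasDerivAt_id z).const_mul c).add_const d).cexp
  rw [sphericalDeriv, h1.deriv, hg, norm_mul, Complex.norm_exp]
  set u := (c * z + d).re
  have h2 : 1 + Real.exp u ^ 2 = Real.exp u * (2 * Real.cosh u) := by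
    rw [Real.cosh_eq, Real.exp_neg]
    have := (Real.exp_pos u).ne'
    field_simp
    ring
  have h3 := (Real.exp_pos u).ne'
  have h4 := (Real.cosh_pos u).ne'
  rw [h2]
  field_simp

/-! ### The norm of the differential on open subsets and in affine charts -/

theorem HermitianMetric.normDiff_restrict {E : Type*} [NormedAddCommGroup E] [NormedSpace ℂ E]
    [FiniteDimensional ℂ E] {X : Type*} [TopologicalSpace X] [ChartedSpace E X]
    [IsManifold 𝓘(ℂ, E) ω X] (h : HermitianMetric E X) (U : TopologicalSpace.Opens X) {f : ℂ → U}
    {z : ℂ} (hf : MDifferentiableAt 𝓘(ℂ) 𝓘(ℂ, E) f z) :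
    (h.restrict U).normDiff f z = h.normDiff (fun w ↦ (f w : X)) z := by
  have hval : MDifferentiableAt 𝓘(ℂ, E) 𝓘(ℂ, E) (Subtype.val : U → X) (f z) :=
    (contMDiff_subtype_val (n := 1)).mdifferentiableAt (by simp)
  have hcomp : ∀ v : ℂ, (mfderiv 𝓘(ℂ) 𝓘(ℂ, E) (fun w ↦ (f w : X)) z v : E) =
      (mfderiv 𝓘(ℂ, E) 𝓘(ℂ, E) (Subtype.val : U → X) (f z) (mfderiv 𝓘(ℂ) 𝓘(ℂ, E) f z v) : E) :=
    fun v ↦ mfderiv_comp_apply z hval hf v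
  simp only [HermitianMetric.normDiff, HermitianMetric.restrict, map_smul]
  rw [hcomp 1, hcomp Complex.I]

namespace CP1

/-- With `F` the curve in the chart, `df(∂/∂x) = F'` and `df(∂/∂y) = iF'` contribute equally. The
factors `1/4` and `√2` then cancel, and `√π` remains from the normalisation of the form. -/
theorem fubiniStudy_normDiff {f : ℂ → CP1} {z : ℂ} (hf : MDifferentiableAt 𝓘(ℂ) 𝓘(ℂ) f z)
    {i : Fin 2} (hi : affineChart i = chartAt ℂ (f z)) :
    DifferentiableAt ℂ (fun w ↦ affineChart i (f w)) z ∧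
      fubiniStudy.normDiff f z = sphericalDeriv (fun w ↦ affineChart i (f w)) z / √Real.pi := by
  set F : ℂ → ℂ := fun w ↦ affineChart i (f w) with hFdef
  have hw : writtenInExtChartAt 𝓘(ℂ) 𝓘(ℂ) z f = F := by rw [hFdef, hi]; rfl
  have hF : DifferentiableAt ℂ F z := by
    have h1 := hf.differentiableWithinAt_writtenInExtChartAt
    rw [hw] at h1
    change DifferentiableWithinAt ℂ F (range (id : ℂ → ℂ)) z at h1
    rwa [range_id, differentiableWithinAt_univ] at h1
  refine ⟨hF, ?_⟩
  have hm : ∀ v : ℂ, (mfderiv 𝓘(ℂ) 𝓘(ℂ) f z v : ℂ) = v * deriv F z := fun v ↦ by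
    rw [hf.mfderiv, hw]
    change fderivWithin ℂ F (range (id : ℂ → ℂ)) z v = _
    rw [range_id, fderivWithin_univ, fderiv_eq_smul_deriv, smul_eq_mul]
  have hc : ∀ u : ℂ, fubiniStudyInner (f z) u u =
      ‖u‖ ^ 2 / (Real.pi * (1 + ‖F z‖ ^ 2) ^ 2) := fun u ↦ by
    rw [fubiniStudyInner, fubiniStudyCoeff_eq, ← hi, Complex.mul_conj', ← Complex.ofReal_pow,
      Complex.ofReal_re]
    have := Real.pi_pos.ne'
    have : (1 + ‖F z‖ ^ 2) ≠ 0 := by positivity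
    change 2 * (1 / (2 * Real.pi * (1 + ‖F z‖ ^ 2) ^ 2)) * ‖u‖ ^ 2 = _
    field_simp
  have hpt : ∀ m₁ m₂ : ℂ, (mfderiv 𝓘(ℂ) 𝓘(ℂ) f z (1 : ℂ) : ℂ) = m₁ →
      (mfderiv 𝓘(ℂ) 𝓘(ℂ) f z Complex.I : ℂ) = m₂ → fubiniStudy.normDiff f z =
        √2 * √(fubiniStudyInner (f z) ((1 / 2 : ℂ) * m₁) ((1 / 2 : ℂ) * m₁) +
          fubiniStudyInner (f z) ((-1 / 2 : ℂ) * m₂) ((-1 / 2 : ℂ) * m₂)) := by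
    rintro _ _ rfl rfl
    rfl
  rw [hpt _ _ (hm 1) (hm Complex.I), hc, hc, ← Real.sqrt_mul zero_le_two]
  have h2 : sphericalDeriv F z / √Real.pi = √(sphericalDeriv F z ^ 2 / Real.pi) := by
    rw [Real.sqrt_div (sq_nonneg _), Real.sqrt_sq (by unfold sphericalDeriv; positivity)]
  rw [h2, sphericalDeriv]
  congr 1
  simp only [norm_mul, norm_div, norm_neg, norm_one, Complex.norm_I, Complex.norm_two]
  have := Real.pi_pos.ne'
  have : (1 + ‖F z‖ ^ 2) ≠ 0 := by positivity
  field_simp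
  ring

/-! ### The cross ratio and reduction to zero-free entire functions -/

/-- The linear form `v ↦ a₀ v₁ - a₁ v₀`, vanishing at `a`. -/
noncomputable def crossForm (a v : Fin 2 → ℂ) : ℂ := a 0 * v 1 - a 1 * v 0

/-- `crossForm a v` is the determinant of `a` and `v`, so its vanishing makes them proportional. -/
theorem mk_eq_mk_of_crossForm_eq_zero {a v : Fin 2 → ℂ} (ha : a ≠ 0) (hv : v ≠ 0)
    (h : crossForm a v = 0) : Projectivization.mk ℂ v hv = Projectivization.mk ℂ a ha := by
  have h' : a 0 * v 1 = a 1 * v 0 := sub_eq_zero.1 h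
  rw [Projectivization.mk_eq_mk_iff']
  by_cases h0 : a 0 = 0
  · have h1 : a 1 ≠ 0 := fun h1 ↦ ha (by ext j; fin_cases j <;> simp [h0, h1])
    have hv0 : v 0 = 0 := by simpa [h0, h1] using h'
    refine ⟨v 1 / a 1, ?_⟩
    ext j
    fin_cases j
    · simp [h0, hv0]
    · simp [h1]
  · refine ⟨v 0 / a 0, ?_⟩
    ext j
    fin_cases j
    · simp [h0]
    · simp only [Fin.mk_one, Pi.smul_apply, smul_eq_mul]
      field_simp
      linear_combination -h'

/-- The fractional linear transformation with a zero at `[a]` and a pole at `[b]`. -/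
noncomputable def crossRatio (a b : Fin 2 → ℂ) : CP1 → ℂ :=
  Projectivization.lift (fun v : {v : Fin 2 → ℂ // v ≠ 0} ↦ crossForm a v.1 / crossForm b v.1)
    (by
      rintro ⟨u, hu⟩ ⟨v, hv⟩ t h
      obtain rfl : u = t • v := h
      have ht : t ≠ 0 := by rintro rfl; simp at hu
      have : ∀ c : Fin 2 → ℂ, crossForm c (t • v) = t * crossForm c v := fun c ↦ by
        simp only [crossForm, Pi.smul_apply, smul_eq_mul]; ring
      simp only [this, mul_div_mul_left _ _ ht])

/-- Avoiding `[b]` is needed too: at the pole the convention `x / 0 = 0` gives the value `0`. -/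
theorem crossRatio_ne_zero {a b : Fin 2 → ℂ} (ha : a ≠ 0) (hb : b ≠ 0) {p : CP1}
    (hpa : p ≠ Projectivization.mk ℂ a ha) (hpb : p ≠ Projectivization.mk ℂ b hb) :
    crossRatio a b p ≠ 0 := by
  induction p using Projectivization.ind with
  | h v hv =>
    exact div_ne_zero (fun h ↦ hpa (mk_eq_mk_of_crossForm_eq_zero ha hv h))
      (fun h ↦ hpb (mk_eq_mk_of_crossForm_eq_zero hb hv h))

theorem crossRatio_eq_of_mem {p : CP1} {i : Fin 2} (hp : p ∈ (affineChart i).source)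
    (a b : Fin 2 → ℂ) : crossRatio a b p =
      crossForm a (affineVec i (affineChart i p)) / crossForm b (affineVec i (affineChart i p)) := by
  conv_lhs => rw [← (affineChart i).left_inv hp]
  rfl

/-- In the `i`-th chart, the form `crossForm a` is affine. -/
theorem crossForm_affineVec (i : Fin 2) (a : Fin 2 → ℂ) (z : ℂ) :
    crossForm a (affineVec i z) = (-1) ^ (i : ℕ) * a i * z + (-1) ^ (i.rev : ℕ) * a i.rev := by
  fin_cases i <;> simp [crossForm, affineVec] <;> ring

/-- A holomorphic curve avoiding two points has spherical derivative comparable with that of a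
nonvanishing entire function. -/
theorem exists_entire_comparable {a b : Fin 2 → ℂ} (ha : a ≠ 0) (hb : b ≠ 0)
    (hab : Projectivization.mk ℂ a ha ≠ Projectivization.mk ℂ b hb) {f : ℂ → CP1}
    (hf : MDifferentiable 𝓘(ℂ) 𝓘(ℂ) f) (hfa : ∀ z, f z ≠ Projectivization.mk ℂ a ha)
    (hfb : ∀ z, f z ≠ Projectivization.mk ℂ b hb) :
    ∃ (g : ℂ → ℂ) (K : ℝ), 0 ≤ K ∧ Differentiable ℂ g ∧ (∀ z, g z ≠ 0) ∧
      ∀ z, sphericalDeriv g z ≤ K * fubiniStudy.normDiff f z ∧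
        fubiniStudy.normDiff f z ≤ K * sphericalDeriv g z := by
  have hD : crossForm a b ≠ 0 := fun h ↦ hab (mk_eq_mk_of_crossForm_eq_zero ha hb h).symm
  set K₀ : ℝ := (‖a 0‖ ^ 2 + ‖a 1‖ ^ 2 + ‖b 0‖ ^ 2 + ‖b 1‖ ^ 2) / ‖crossForm a b‖ with hK₀
  have hK₀0 : 0 ≤ K₀ := by positivity
  have hmain : ∀ z, DifferentiableAt ℂ (fun w ↦ crossRatio a b (f w)) z ∧
      sphericalDeriv (fun w ↦ crossRatio a b (f w)) z ≤
        K₀ * √Real.pi * fubiniStudy.normDiff f z ∧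
      fubiniStudy.normDiff f z ≤
        K₀ / √Real.pi * sphericalDeriv (fun w ↦ crossRatio a b (f w)) z := by
    intro z
    obtain ⟨i, hi⟩ : chartAt ℂ (f z) ∈ range affineChart := chart_mem_atlas ℂ (f z)
    obtain ⟨hF, hn⟩ := fubiniStudy_normDiff (hf z) hi
    have hmem : f z ∈ (affineChart i).source := hi ▸ mem_chart_source ℂ (f z)
    have hev : (fun w ↦ crossRatio a b (f w)) =ᶠ[𝓝 z] fun w ↦
        ((-1) ^ (i : ℕ) * a i * affineChart i (f w) + (-1) ^ (i.rev : ℕ) * a i.rev) /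
        ((-1) ^ (i : ℕ) * b i * affineChart i (f w) + (-1) ^ (i.rev : ℕ) * b i.rev) := by
      filter_upwards [(hf z).continuousAt.preimage_mem_nhds
        ((affineChart i).open_source.mem_nhds hmem)] with w hw
      rw [crossRatio_eq_of_mem hw, crossForm_affineVec, crossForm_affineVec]
    have hB : (-1) ^ (i : ℕ) * b i * affineChart i (f z) + (-1) ^ (i.rev : ℕ) * b i.rev ≠ 0 := by
      intro h0
      -- A vanishing denominator would make the quotient `0` by convention, but the cross ratio is
      -- nonzero along the curve.
      refine crossRatio_ne_zero ha hb (hfa z) (hfb z) ?_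
      rw [hev.eq_of_nhds, h0, div_zero]
    -- Switching charts changes the determinant only by a sign, so one constant `K₀` serves at every
    -- point.
    have hdet : ‖(-1) ^ (i : ℕ) * a i * ((-1) ^ (i.rev : ℕ) * b i.rev) -
        (-1) ^ (i.rev : ℕ) * a i.rev * ((-1) ^ (i : ℕ) * b i)‖ = ‖crossForm a b‖ := by
      fin_cases i
      · rw [← norm_neg]; congr 1; simp [crossForm]; ring
      · congr 1; simp [crossForm]; ring
    have hK : K₀ = (‖(-1) ^ (i : ℕ) * a i‖ ^ 2 + ‖(-1) ^ (i.rev : ℕ) * a i.rev‖ ^ 2 +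
        ‖(-1) ^ (i : ℕ) * b i‖ ^ 2 + ‖(-1) ^ (i.rev : ℕ) * b i.rev‖ ^ 2) /
        ‖(-1) ^ (i : ℕ) * a i * ((-1) ^ (i.rev : ℕ) * b i.rev) -
        (-1) ^ (i.rev : ℕ) * a i.rev * ((-1) ^ (i : ℕ) * b i)‖ := by
      rw [hdet, hK₀]
      congr 1
      fin_cases i
      · simp
      · simp; ring
    obtain ⟨h1, h2, h3⟩ := sphericalDeriv_mobius hF hB
      (norm_pos_iff.1 (hdet ▸ norm_pos_iff.2 hD)) hev hK
    have hpi : √Real.pi ≠ 0 := by positivity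
    refine ⟨h1, ?_, ?_⟩
    · rw [hn]
      refine h2.trans_eq ?_
      field_simp
    · rw [hn, div_mul_eq_mul_div]
      gcongr
  have hpos : ∀ z, 0 ≤ fubiniStudy.normDiff f z := fun z ↦ by
    unfold HermitianMetric.normDiff; positivity
  have hpos' : ∀ z, 0 ≤ sphericalDeriv (fun w ↦ crossRatio a b (f w)) z := fun z ↦ by
    unfold sphericalDeriv; positivity
  refine ⟨fun w ↦ crossRatio a b (f w), max (K₀ * √Real.pi) (K₀ / √Real.pi),
    le_max_of_le_left (by positivity), fun z ↦ (hmain z).1,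
    fun z ↦ crossRatio_ne_zero ha hb (hfa z) (hfb z), fun z ↦ ⟨?_, ?_⟩⟩
  · exact (hmain z).2.1.trans (mul_le_mul_of_nonneg_right (le_max_left _ _) (hpos z))
  · exact (hmain z).2.2.trans (mul_le_mul_of_nonneg_right (le_max_right _ _) (hpos' z))

end CP1

/-! ### Vanishing of the packing density -/

theorem packingDensity_eq_zero_of_exp_affine {E : Type*} [NormedAddCommGroup E] [NormedSpace ℂ E]
    [FiniteDimensional ℂ E] {X : Type*} [TopologicalSpace X] [ChartedSpace E X]
    [IsManifold 𝓘(ℂ, E) ω X] (h : HermitianMetric E X) {f : ℂ → X} {C : ℝ} {c d : ℂ}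
    (hf : ∀ z, h.normDiff f z ≤ C * (‖c‖ * (Real.cosh (c * z + d).re)⁻¹)) :
    h.packingDensity f = 0 := by
  have hpos : ∀ z, 0 ≤ h.normDiff f z := fun z ↦ by
    unfold HermitianMetric.normDiff; positivity
  refine Tendsto.limsup_eq ?_
  -- For `c = 0` the `cosh` factor is constant and its averages do not decay; the factor `‖c‖` in
  -- the bound makes the differential vanish instead.
  by_cases hc : c = 0
  · have h0 : ∀ z, h.normDiff f z = 0 := fun z ↦
      le_antisymm ((hf z).trans_eq (by simp [hc])) (hpos z)
    simp [h0]
  have hlim := ENNReal.Tendsto.const_mul (a := ENNReal.ofReal ((C * ‖c‖) ^ 2))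
    (tendsto_average_inv_cosh_sq hc d) (Or.inr ENNReal.ofReal_ne_top)
  rw [mul_zero] at hlim
  refine tendsto_of_tendsto_of_tendsto_of_le_of_le tendsto_const_nhds hlim
    (fun _ ↦ zero_le) fun R ↦ ?_
  dsimp only
  rw [← mul_div_assoc, ← lintegral_const_mul' _ _ ENNReal.ofReal_ne_top]
  gcongr with z
  rw [← ENNReal.ofReal_mul (sq_nonneg _)]
  refine ENNReal.ofReal_le_ofReal ?_
  calc h.normDiff f z ^ 2 ≤ (C * (‖c‖ * (Real.cosh (c * z + d).re)⁻¹)) ^ 2 :=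
        pow_le_pow_left₀ (hpos z) (hf z) 2
    _ = _ := by rw [← inv_pow]; ring

theorem mainTheorem6 (w₁ w₂ : CP1) (hw : w₁ ≠ w₂) :
    (CP1.fubiniStudy.restrict (CP1.complPair w₁ w₂)).capacity = 0 := by
  induction w₁ using Projectivization.ind with
  | h a ha =>
  induction w₂ using Projectivization.ind with
  | h b hb =>
  simp only [HermitianMetric.capacity, ENNReal.iSup_eq_zero]
  rintro f ⟨hf, hf1⟩
  have hfd : MDifferentiable 𝓘(ℂ) 𝓘(ℂ) fun z ↦ (f z : CP1) := fun z ↦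
    MDifferentiableAt.comp z
      ((contMDiff_subtype_val (n := 1)).mdifferentiableAt (by simp)) (hf z)
  have hmem : ∀ z, (f z : CP1) ≠ Projectivization.mk ℂ a ha ∧
      (f z : CP1) ≠ Projectivization.mk ℂ b hb := fun z ↦ by
    have h1 : (f z : CP1) ∉ ({Projectivization.mk ℂ a ha, Projectivization.mk ℂ b hb} : Set CP1) :=
      (f z).2
    simpa [not_or] using h1
  obtain ⟨g, K, hK, hg, hg0, hgf⟩ := CP1.exists_entire_comparable ha hb hw hfd
    (fun z ↦ (hmem z).1) (fun z ↦ (hmem z).2)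
  have hnd : ∀ z, (CP1.fubiniStudy.restrict _).normDiff f z = _ := fun z ↦
    CP1.fubiniStudy.normDiff_restrict _ (hf z)
  -- Here `|df| ≤ 1` enters: it bounds the spherical derivative of `g` by `K`.
  obtain ⟨c, d, hcd⟩ := exists_eq_exp_affine hg hg0 (C := K) fun z ↦
    (hgf z).1.trans (mul_le_of_le_one_right hK (hnd z ▸ hf1 z))
  refine packingDensity_eq_zero_of_exp_affine _ (C := K / 2) (c := c) (d := d) fun z ↦ ?_
  rw [hnd]
  refine (hgf z).2.trans_eq ?_
  rw [sphericalDeriv_exp_affine hcd]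
  ring
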